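/- Let $p \ge 0$ be an integer and let $V$ be a finite set with $|V|$ even. Let $\mathcal{G}(V,p)$ be the set of $p$-regular multigraphs on the labelled vertex set $V$, where loops and parallel edges are allowed and a loop contributes $2$ to the degree of its vertex. Thus an element of $\mathcal{G}(V,p)$ is determined by its multiset of edges. Two multigraphs $G, H \in \mathcal{G}(V,p)$ are related by a switching if there are two distinct (possibly parallel) edges $\{v,w\}, \{v',w'\}$ of $G$ such that $H$ is obtained from $G$ by replacing these two edges with the edges $\{v,v'\}, \{w,w'\}$. Let $d_{\mathrm{switch}}(G,H)$ be the minimum number of switchings needed to reach $H$ from $G$ ($\infty$ if this is impossible). Let $\mathcal{F} \subseteq \mathcal{G}(V,p)$ be the set of disjoint unions of Frobenius pairs, that is, of multigraphs obtained by partitioning $V$ into pairs and joining the two vertices of each pair by exactly $p$ parallel edges, with no other edges. Put $d_{\mathrm{switch}}(G,\mathcal{F}) = \min_{F \in \mathcal{F}} d_{\mathrm{switch}}(G,F)$. For an edge coloring $\sigma : E(G) \to C$ with a finite set $C$ of colors, let $\sigma(\partial v)$ be the multiset of colors of the edges incident to $v$, where the color of a loop at $v$ is counted twice. Call $\sigma$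 even if every multiset of colors equals $\sigma(\partial v)$ for an even number of vertices $v \in V$. Let $c_{\max}(G)$ be the maximum of $|\sigma(E(G))|$ over all even edge colorings $\sigma$ of $G$. Then for every $G \in \mathcal{G}(V,p)$ the distance $d_{\mathrm{switch}}(G,\mathcal{F})$ is finite and $$c_{\max}(G) = |E(G)| - d_{\mathrm{switch}}(G,\mathcal{F}).$$ -/

import Mathlib

/-- A finite multigraph on the labelled vertex set `V`, with loops and parallel edges allowed:
the multiset of its edges, each edge being an unordered pair of (possibly equal) vertices. -/
abbrev MultiGraph (V : Type*) := Multiset (Sym2 V)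

namespace MultiGraph

/-- The number of half-edges of the edge `e` at `v`: `0` or `1` if `e` is not a loop,
and `2` if `e` is a loop at `v`. -/
def inc {V : Type*} [DecidableEq V] (e : Sym2 V) (v : V) : ℕ := e.toMultiset.count v

/-- The degree of a vertex; a loop counts twice. -/
def degree {V : Type*} [DecidableEq V] (G : MultiGraph V) (v : V) : ℕ :=
  (G.map fun e => inc e v).sum

/-- The set `𝒢(V, p)` of labelled multigraphs on `V` with degree sequence `p`. -/
abbrev WithDegrees (V : Type*) [DecidableEq V] (p : V → ℕ) :=
  {G : MultiGraph V // ∀ v, G.degree v = p v}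

/-- `H` arises from `G` by replacing two distinct edges (distinct members of the edge multiset,
possibly parallel) `{v, w}`, `{v', w'}` by `{v, v'}`, `{w, w'}`. -/
def Switching {V : Type*} (G H : MultiGraph V) : Prop :=
  ∃ (v w v' w' : V) (R : MultiGraph V),
    G = s(v, w) ::ₘ s(v', w') ::ₘ R ∧ H = s(v, v') ::ₘ s(w, w') ::ₘ R

/-- `𝒢(V, p)` viewed as a graph whose adjacency is being (distinct and) related by a switching. -/
def switchGraph (V : Type*) [DecidableEq V] (p : V → ℕ) : SimpleGraph (WithDegrees V p) :=
  SimpleGraph.fromRel fun G H => Switching G.1 H.1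

/-- The switching distance on `𝒢(V, p)` (`⊤` if there is no path). -/
noncomputable def dSwitch {V : Type*} [DecidableEq V] {p : V → ℕ} (G H : WithDegrees V p) : ℕ∞ :=
  (switchGraph V p).edist G H

/-- The switching distance from a multigraph to a set of multigraphs (`⊤` for the empty set). -/
noncomputable def dSwitchSet {V : Type*} [DecidableEq V] {p : V → ℕ} (G : WithDegrees V p)
    (S : Set (WithDegrees V p)) : ℕ∞ :=
  ⨅ H ∈ S, dSwitch G H

/-- The set `ℱ(V, p)` of disjoint unions of Frobenius pairs: `V` is partitioned into pairs of
distinct vertices, each pair is joined by `p` parallel edges, and there are no other edges. -/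
def frobenii (V : Type*) [DecidableEq V] (p : ℕ) : Set (WithDegrees V fun _ => p) :=
  {F | ∃ M : Finset (Sym2 V), (∀ e ∈ M, ¬ e.IsDiag) ∧ (∀ v, ∃! e, e ∈ M ∧ v ∈ e) ∧
    F.1 = ∑ e ∈ M, Multiset.replicate p e}

/-- The multiset `σ(∂v)` of colors of the edges at `v`; the color of a loop at `v` occurs twice.
The type `G` of edges has one element for each edge, counted with multiplicity. -/
def colorNbhd {V : Type*} [DecidableEq V] {G : MultiGraph V} {C : Type*} (σ : G → C) (v : V) :
    Multiset C :=
  ∑ e : G, inc (e : Sym2 V) v • ({σ e} : Multiset C)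

/-- A coloring is even if every multiset of colors is the colored neighborhood of an even number
of vertices. -/
def IsEvenColoring {V : Type*} [DecidableEq V] {G : MultiGraph V} {C : Type*} (σ : G → C) : Prop :=
  ∀ N : Multiset C, Even {v | colorNbhd σ v = N}.ncard

/-- The possible numbers of colors `|σ(E)|` used by an even coloring of the edges of `G`. -/
def evenColorCounts {V : Type*} [DecidableEq V] (G : MultiGraph V) : Set ℕ :=
  {k | ∃ (C : Type) (_ : Finite C) (σ : G → C), IsEvenColoring σ ∧ (Set.range σ).ncard = k}

/-- The largest number of colors in an even edge coloring. -/
noncomputable def cMax {V : Type*} [DecidableEq V] (G : MultiGraph V) : ℕ :=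
  sSup (evenColorCounts G)

/-- On an even number of vertices the supremum defining `cMax` is a maximum. -/
theorem isGreatest_cMax {V : Type*} [Fintype V] [DecidableEq V] (hV : Even (Fintype.card V))
    {p : ℕ} (G : WithDegrees V fun _ => p) : IsGreatest (evenColorCounts G.1) (cMax G.1) := by
  have hb : BddAbove (evenColorCounts G.1) := by
    refine ⟨Nat.card G.1, ?_⟩
    rintro k ⟨C, _, σ, -, rfl⟩
    rw [← Set.image_univ, ← Set.ncard_univ]
    exact Set.ncard_image_le
  have hne : (evenColorCounts G.1).Nonempty := by
    refine ⟨_, Unit, inferInstance, fun _ => (), ?_, rfl⟩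
    have key : ∀ v, colorNbhd (G := G.1) (fun _ => ()) v = Multiset.replicate p () := by
      intro v
      have h : (∑ e : G.1, inc (e : Sym2 V) v) = p := by
        have h1 : G.1.degree v = p := G.2 v
        rw [degree, ← Multiset.map_univ G.1 (fun e => inc e v)] at h1
        exact h1
      rw [colorNbhd, ← Finset.sum_smul, h, Multiset.nsmul_singleton]
    intro N
    by_cases hN : Multiset.replicate p () = N
    · have : {v : V | colorNbhd (G := G.1) (fun _ => ()) v = N} = Set.univ := by
        ext v; simp [key, hN]
      rw [this, Set.ncard_univ, Nat.card_eq_fintype_card]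
      exact hV
    · have : {v : V | colorNbhd (G := G.1) (fun _ => ()) v = N} = ∅ := by
        ext v; simp [key, hN]
      rw [this]; simp
  exact ⟨Nat.sSup_mem hne hb, fun k hk => le_csSup hb hk⟩

end MultiGraph

namespace MultiGraph

/-! A coloring is even exactly when some fixed-point-free involution `f` of the vertices preserves
the colored neighborhoods. Both inequalities work with such a matching `f`.

From a coloring to switchings: each color class has `f`-invariant degrees. If it contains an edge
`{v, x}` with `x ≠ f v`, it also contains some `{f v, y}`, and one switching creates `{v, f v}`. The
last edge is matched automatically, so a class of `m` edges needs at most `m - 1` switchings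
(`exists_switchReach_matched`). Summing over classes gives at most `|E|` minus the number of colors,
and a regular multigraph with only matched edges is a union of Frobenius pairs.

From switchings to a coloring: in a union of Frobenius pairs all edges may get different colors.
Going back along a path to `G`, merging the colors of the two switched edges keeps the coloring even
and loses at most one color per step (`Switching.exists_mem_evenColorCounts`). -/

/-- A function on a finite type has fibers of even size if and only if it is invariant under a
fixed-point-free involution. -/
theorem even_ncard_fibers_iff {V X : Type*} [Finite V] (g : V → X) :
    (∀ N, Even {v | g v = N}.ncard) ↔
      ∃ f : V → V, (∀ v, f (f v) = v) ∧ (∀ v, f v ≠ v) ∧ ∀ v, g (f v) = g v := by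
  classical
  have := Fintype.ofFinite V
  constructor
  · intro h
    have key : ∀ N, ∃ f : {v // g v = N} → {v // g v = N}, (∀ v, f (f v) = v) ∧ ∀ v, f v ≠ v := by
      intro N
      obtain ⟨k, hk⟩ := h N
      -- Model the fiber as `Fin k × Bool`; flipping the bit is the involution.
      have hcard : Fintype.card {v // g v = N} = Fintype.card (Fin k × Bool) := by
        rw [← Nat.card_eq_fintype_card]
        change Nat.card ↥{v | g v = N} = _
        rw [Nat.card_coe_set_eq, hk]
        simp [mul_two]
      let ε := Fintype.equivOfCardEq hcard
      refine ⟨fun v => ε.symm ((ε v).1, !(ε v).2), fun v => by simp, fun v hv => ?_⟩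
      have := congrArg (fun x => (ε x).2) hv
      simp at this
    choose f hf hne using key
    have hval : ∀ (N : X) (v : V) (hv : g v = N), (f (g v) ⟨v, rfl⟩ : V) = f N ⟨v, hv⟩ := by
      rintro N v rfl; rfl
    refine ⟨fun v => f (g v) ⟨v, rfl⟩, fun v => ?_, fun v hv => ?_, fun v => ?_⟩
    · refine (hval (g v) _ (f (g v) ⟨v, rfl⟩).2).trans ?_
      exact congrArg Subtype.val (hf (g v) ⟨v, rfl⟩)
    · exact hne (g v) ⟨v, rfl⟩ (Subtype.ext hv)
    · exact (f (g v) ⟨v, rfl⟩).2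
  · rintro ⟨f, hf, hne, hg⟩ N
    -- Counted modulo 2, the pairs `v`, `f v` cancel.
    have h : ∑ v ∈ Finset.univ.filter (fun v => g v = N), (1 : ZMod 2) = 0 := by
      refine Finset.sum_involution (fun v _ => f v) (fun _ _ => by decide) (fun v _ _ => hne v)
        (fun v hv => ?_) (fun v _ => hf v)
      simpa [hg] using hv
    rw [Finset.sum_const, nsmul_one, ZMod.natCast_eq_zero_iff_even] at h
    rwa [Set.ncard_eq_toFinset_card', Set.toFinset_ofPred]

/-! ### Half-edges and degrees -/

section Degree

variable {V : Type*} [DecidableEq V]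

theorem inc_mk (a b v : V) :
    inc s(a, b) v = (if v = a then 1 else 0) + (if v = b then 1 else 0) := by
  change Multiset.count v (a ::ₘ b ::ₘ 0) = _
  simp only [Multiset.count_cons, Multiset.count_zero, zero_add, add_comm]

theorem inc_eq_zero_iff {e : Sym2 V} {v : V} : inc e v = 0 ↔ v ∉ e := by
  simp [inc, Multiset.count_eq_zero]

theorem inc_switch (a b c d v : V) :
    inc s(a, b) v + inc s(c, d) v = inc s(a, c) v + inc s(b, d) v := by
  simp only [inc_mk]; omega

/-- An edge joining two vertices that are matched by an involution has the same number of
half-edges at matched vertices. -/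
theorem inc_matched {f : V → V} (hf : ∀ v, f (f v) = v) (a v : V) :
    inc s(a, f a) (f v) = inc s(a, f a) v := by
  have h1 : f v = a ↔ v = f a := ⟨fun h => by rw [← h, hf], fun h => by rw [h, hf]⟩
  have h2 : f v = f a ↔ v = a := ⟨fun h => by rw [← hf v, h, hf], fun h => by rw [h]⟩
  simp only [inc_mk, h1, h2, add_comm]

theorem degree_cons (e : Sym2 V) (G : MultiGraph V) (v : V) :
    degree (e ::ₘ G) v = inc e v + degree G v := by
  simp [degree]

theorem exists_mem_of_degree_ne_zero {G : MultiGraph V} {v : V} (h : degree G v ≠ 0) :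
    ∃ e ∈ G, v ∈ e := by
  by_contra! hc
  refine h (Multiset.sum_eq_zero fun x hx => ?_)
  obtain ⟨e, he, rfl⟩ := Multiset.mem_map.1 hx
  exact inc_eq_zero_iff.2 (hc e he)

end Degree

/-! ### Switching sequences and matched edges -/

section Switching

variable {V : Type*}

theorem Switching.symm {G H : MultiGraph V} (h : Switching G H) : Switching H G := by
  obtain ⟨v, w, v', w', R, rfl, rfl⟩ := h
  exact ⟨v, v', w, w', R, rfl, rfl⟩

theorem Switching.add_right {G H : MultiGraph V} (h : Switching G H) (L : MultiGraph V) :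
    Switching (G + L) (H + L) := by
  obtain ⟨v, w, v', w', R, rfl, rfl⟩ := h
  exact ⟨v, w, v', w', R + L, by simp, by simp⟩

theorem Switching.degree_eq [DecidableEq V] {G H : MultiGraph V} (h : Switching G H) (v : V) :
    degree G v = degree H v := by
  obtain ⟨a, b, c, d, R, rfl, rfl⟩ := h
  simp only [degree_cons, ← add_assoc, inc_switch]

theorem Switching.card_eq {G H : MultiGraph V} (h : Switching G H) :
    Multiset.card G = Multiset.card H := by
  obtain ⟨a, b, c, d, R, rfl, rfl⟩ := h
  simp

/-- `SwitchReach n G H` says that `H` arises from `G` by a sequence of `n` switchings. -/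
inductive SwitchReach : ℕ → MultiGraph V → MultiGraph V → Prop
  | refl (G : MultiGraph V) : SwitchReach 0 G G
  | step {n : ℕ} {G H L : MultiGraph V} : Switching G H → SwitchReach n H L →
      SwitchReach (n + 1) G L

theorem SwitchReach.trans {m n : ℕ} {G H L : MultiGraph V} (h : SwitchReach m G H)
    (h' : SwitchReach n H L) : SwitchReach (m + n) G L := by
  induction h with
  | refl G => simpa using h'
  | step hs _ ih => rw [Nat.add_right_comm]; exact .step hs (ih h')

theorem SwitchReach.add_right {n : ℕ} {G H : MultiGraph V} (h : SwitchReach n G H)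
    (L : MultiGraph V) : SwitchReach n (G + L) (H + L) := by
  induction h with
  | refl G => exact .refl _
  | step hs _ ih => exact .step (hs.add_right L) ih

theorem SwitchReach.add {m n : ℕ} {G H G' H' : MultiGraph V} (h : SwitchReach m G H)
    (h' : SwitchReach n G' H') : SwitchReach (m + n) (G + G') (H + H') := by
  refine (h.add_right G').trans ?_
  rw [add_comm H, add_comm H]
  exact h'.add_right H

theorem SwitchReach.exists_edist_le [DecidableEq V] {p : V → ℕ} {n : ℕ} {G H : MultiGraph V}
    (h : SwitchReach n G H) (hG : ∀ v, degree G v = p v) :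
    ∃ hH : ∀ v, degree H v = p v,
      dSwitch (⟨G, hG⟩ : WithDegrees V p) (⟨H, hH⟩ : WithDegrees V p) ≤ n := by
  induction h with
  | refl G => exact ⟨hG, by simp [dSwitch]⟩
  | @step n G H L hs _ ih =>
    have hH : ∀ v, degree H v = p v := fun v => (hs.degree_eq v).symm.trans (hG v)
    obtain ⟨hL, hle⟩ := ih hH
    refine ⟨hL, ?_⟩
    -- A switching may leave the multigraph unchanged, while `switchGraph` has no loops; hence only
    -- `≤ 1`.
    have hone : dSwitch (⟨G, hG⟩ : WithDegrees V p) (⟨H, hH⟩ : WithDegrees V p) ≤ 1 := by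
      rw [dSwitch, SimpleGraph.edist_le_one_iff_adj_or_eq]
      by_cases heq : (⟨G, hG⟩ : WithDegrees V p) = ⟨H, hH⟩
      · exact .inr heq
      · exact .inl ((SimpleGraph.fromRel_adj _ _ _).2 ⟨heq, .inl hs⟩)
    calc _ ≤ _ := SimpleGraph.edist_triangle (v := (⟨H, hH⟩ : WithDegrees V p))
      _ ≤ 1 + n := add_le_add hone hle
      _ = _ := by push_cast; rw [add_comm]

/-- A nonempty multigraph whose degrees are invariant under a fixed-point-free involution can be
turned into a union of edges between matched vertices by fewer switchings than it has edges. -/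
theorem exists_switchReach_matched [DecidableEq V] {f : V → V} (hf : ∀ v, f (f v) = v)
    (hne : ∀ v, f v ≠ v) (A : MultiGraph V) (hA : A ≠ 0)
    (hdeg : ∀ v, degree A (f v) = degree A v) :
    ∃ n B, n < Multiset.card A ∧ SwitchReach n A B ∧ ∀ e ∈ B, ∃ v, e = s(v, f v) := by
  induction hn : Multiset.card A generalizing A with
  | zero => exact absurd (Multiset.card_eq_zero.1 hn) hA
  | succ k ih =>
    have hrest : ∀ (v : V) (R : MultiGraph V),
        (∀ x, degree (s(v, f v) ::ₘ R) (f x) = degree (s(v, f v) ::ₘ R) x) →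
          ∀ x, degree R (f x) = degree R x := by
      intro v R h x
      have := h x
      rwa [degree_cons, degree_cons, inc_matched hf, Nat.add_left_cancel_iff] at this
    obtain ⟨e, he⟩ := Multiset.exists_mem_of_ne_zero hA
    obtain ⟨R, rfl⟩ := Multiset.exists_cons_of_mem he
    induction e with | _ v x
    simp only [Multiset.card_cons, Nat.add_right_cancel_iff] at hn
    by_cases hx : x = f v
    · subst hx
      -- A matched last edge costs nothing: this is the one switching saved in `n < card`.
      by_cases hR : R = 0
      · subst hR
        exact ⟨0, _, Nat.succ_pos _, .refl _, fun e he => ⟨v, by simpa using he⟩⟩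
      · obtain ⟨n, B, hlt, hreach, hB⟩ := ih R hR (hrest v R hdeg) hn
        refine ⟨n, B + {s(v, f v)}, by omega, ?_, ?_⟩
        · rw [← Multiset.singleton_add, add_comm]
          exact hreach.add_right _
        · intro e he
          rcases Multiset.mem_add.1 he with he | he
          · exact hB e he
          · exact ⟨v, by simpa using he⟩
    -- `{v, x}` misses `f v`, yet `f v` has the same positive degree as `v`, so another edge meets
    -- it.
    · have hdv : degree R (f v) ≠ 0 := by
        have h := hdeg v
        rw [degree_cons, degree_cons, inc_mk, inc_mk] at h
        simp only [hne v, Ne.symm hx, if_true, if_false] at h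
        omega
      obtain ⟨e', he', hmem⟩ := exists_mem_of_degree_ne_zero hdv
      obtain ⟨y, rfl⟩ := Sym2.mem_iff_exists.1 hmem
      obtain ⟨Q, rfl⟩ := Multiset.exists_cons_of_mem he'
      have hs : Switching (s(v, x) ::ₘ s(f v, y) ::ₘ Q) (s(v, f v) ::ₘ s(x, y) ::ₘ Q) :=
        ⟨v, x, f v, y, Q, rfl, rfl⟩
      obtain ⟨n, B, hlt, hreach, hB⟩ := ih (s(x, y) ::ₘ Q) (Multiset.cons_ne_zero)
        (hrest v _ fun z => by rw [← hs.degree_eq, ← hs.degree_eq, hdeg]) (by simpa using hn)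
      refine ⟨n + 1, B + {s(v, f v)}, by omega, .step hs ?_, ?_⟩
      · rw [← Multiset.singleton_add s(v, f v), add_comm]
        exact hreach.add_right _
      · intro e he
        rcases Multiset.mem_add.1 he with he | he
        · exact hB e he
        · exact ⟨v, by simpa using he⟩

end Switching

/-! ### Multisets of colored edges -/

section Colored

variable {V C : Type*} [DecidableEq V]

/-- The multiset of colors at `v` in a multiset of colored edges. -/
def nbhd (K : Multiset (Sym2 V × C)) (v : V) : Multiset C :=
  (K.map fun x => inc x.1 v • ({x.2} : Multiset C)).sum

theorem nbhd_cons (x : Sym2 V × C) (K : Multiset (Sym2 V × C)) (v : V) :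
    nbhd (x ::ₘ K) v = inc x.1 v • {x.2} + nbhd K v := by
  simp [nbhd]

theorem nbhd_map {D : Type*} (g : C → D) (K : Multiset (Sym2 V × C)) (v : V) :
    nbhd (K.map (Prod.map id g)) v = (nbhd K v).map g := by
  induction K using Multiset.induction with
  | empty => rfl
  | cons x K ih => simp [nbhd_cons, ih, Multiset.map_nsmul]

theorem nbhd_filter (P : C → Prop) [DecidablePred P] (K : Multiset (Sym2 V × C)) (v : V) :
    nbhd (K.filter fun x => P x.2) v = (nbhd K v).filter P := by
  induction K using Multiset.induction with
  | empty => rfl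
  | cons x K ih =>
    rw [nbhd_cons, Multiset.filter_add, Multiset.filter_nsmul, ← ih, Multiset.filter_singleton]
    by_cases h : P x.2 <;> simp [h, nbhd_cons]

theorem card_nbhd (K : Multiset (Sym2 V × C)) (v : V) :
    Multiset.card (nbhd K v) = degree (K.map Prod.fst) v := by
  induction K using Multiset.induction with
  | empty => rfl
  | cons x K ih => simp [nbhd_cons, degree_cons, ih]

/-- The multiset of colored edges of an edge coloring. -/
def colored {G : MultiGraph V} (σ : G → C) : Multiset (Sym2 V × C) :=
  Finset.univ.val.map fun e : G => ((e : Sym2 V), σ e)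

theorem map_fst_colored {G : MultiGraph V} (σ : G → C) : (colored σ).map Prod.fst = G := by
  rw [colored, Multiset.map_map]
  exact Multiset.map_univ_coe G

theorem nbhd_colored {G : MultiGraph V} (σ : G → C) : nbhd (colored σ) = colorNbhd σ := by
  funext v
  rw [nbhd, colored, Multiset.map_map]
  rfl

theorem ncard_range_eq_card_colors [DecidableEq C] {G : MultiGraph V} (σ : G → C) :
    (Set.range σ).ncard = ((colored σ).map Prod.snd).toFinset.card := by
  rw [← Set.ncard_coe_finset]
  congr 1
  ext c
  simp [colored]

theorem exists_coloring (K : Multiset (Sym2 V × C)) {G : MultiGraph V}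
    (h : K.map Prod.fst = G) : ∃ σ : G → C, colored σ = K := by
  classical
  subst h
  let ε := K.mapEquiv Prod.fst
  refine ⟨fun e => (ε.symm e : Sym2 V × C).2, ?_⟩
  rw [colored, ← Multiset.map_univ_val_equiv ε, Multiset.map_map]
  conv_rhs => rw [← Multiset.map_univ_coe K]
  refine Multiset.map_congr rfl fun e _ => ?_
  simp [ε, Multiset.mapEquiv_apply]

/-- The working form of even colorings: a multiset of colored edges can be filtered by color or
recolored, and one matching `f` serves all color classes. -/
theorem mem_evenColorCounts_iff [Finite V] {G : MultiGraph V} {k : ℕ} :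
    k ∈ evenColorCounts G ↔ ∃ (C : Type) (_ : Finite C) (_ : DecidableEq C)
      (K : Multiset (Sym2 V × C)) (f : V → V), K.map Prod.fst = G ∧
      (∀ v, f (f v) = v) ∧ (∀ v, f v ≠ v) ∧ (∀ v, nbhd K (f v) = nbhd K v) ∧
      (K.map Prod.snd).toFinset.card = k := by
  classical
  constructor
  · rintro ⟨C, hC, σ, hσ, rfl⟩
    obtain ⟨f, hf, hne, hg⟩ := (even_ncard_fibers_iff _).1 hσ
    exact ⟨C, hC, inferInstance, colored σ, f, map_fst_colored σ, hf, hne,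
      by simpa only [nbhd_colored] using hg, (ncard_range_eq_card_colors σ).symm⟩
  · rintro ⟨C, hC, _, K, f, hK, hf, hne, hg, rfl⟩
    obtain ⟨σ, rfl⟩ := exists_coloring K hK
    exact ⟨C, hC, σ, (even_ncard_fibers_iff _).2
      ⟨f, hf, hne, by simpa only [nbhd_colored] using hg⟩, ncard_range_eq_card_colors σ⟩

/-- If the colored neighborhoods are invariant under a fixed-point-free involution, then treating
each color class separately turns the multigraph into a union of edges between matched vertices. -/
theorem exists_switchReach_matched_of_colored [DecidableEq C] {f : V → V}
    (hf : ∀ v, f (f v) = v) (hne : ∀ v, f v ≠ v) (K : Multiset (Sym2 V × C))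
    (hK : ∀ v, nbhd K (f v) = nbhd K v) :
    ∃ n B, n + (K.map Prod.snd).toFinset.card ≤ Multiset.card K ∧
      SwitchReach n (K.map Prod.fst) B ∧ ∀ e ∈ B, ∃ v, e = s(v, f v) := by
  induction hk : Multiset.card K using Nat.strong_induction_on generalizing K with
  | _ k ih =>
  subst hk
  by_cases h0 : K = 0
  · subst h0
    exact ⟨0, 0, by simp, .refl _, by simp⟩
  obtain ⟨x, hx⟩ := Multiset.exists_mem_of_ne_zero h0
  set K₁ := K.filter fun y => y.2 = x.2 with hK₁
  set K₂ := K.filter fun y => ¬ y.2 = x.2 with hK₂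
  have hsum : K₁ + K₂ = K := Multiset.filter_add_not _ _
  have hx₁ : x ∈ K₁ := Multiset.mem_filter.2 ⟨hx, rfl⟩
  have hcard : Multiset.card K₁ + Multiset.card K₂ = Multiset.card K := by
    rw [← hsum, Multiset.card_add]
  have hpos : 0 < Multiset.card K₁ := Multiset.card_pos_iff_exists_mem.2 ⟨x, hx₁⟩
  -- The degree of `v` within a color class is the multiplicity of that color at `v`, hence
  -- `f`-invariant.
  obtain ⟨n₁, B₁, hlt, hreach₁, hB₁⟩ := exists_switchReach_matched hf hne (K₁.map Prod.fst)
    (fun h => by rw [Multiset.map_eq_zero.1 h] at hx₁; simp at hx₁)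
    (fun v => by
      rw [← card_nbhd, ← card_nbhd, hK₁, nbhd_filter (· = x.2), nbhd_filter (· = x.2), hK])
  obtain ⟨n₂, B₂, hle, hreach₂, hB₂⟩ := ih (Multiset.card K₂) (by omega) K₂
    (fun v => by rw [hK₂, nbhd_filter (¬ · = x.2), nbhd_filter (¬ · = x.2), hK]) rfl
  have hcol : (K.map Prod.snd).toFinset ⊆ insert x.2 (K₂.map Prod.snd).toFinset := by
    intro c hc
    simp only [Multiset.mem_toFinset, Multiset.mem_map, Finset.mem_insert] at hc ⊢
    obtain ⟨y, hy, rfl⟩ := hc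
    by_cases hyx : y.2 = x.2
    · exact .inl hyx
    · exact .inr ⟨y, Multiset.mem_filter.2 ⟨hy, hyx⟩, rfl⟩
  have hcol' := (Finset.card_le_card hcol).trans (Finset.card_insert_le _ _)
  rw [Multiset.card_map] at hlt
  refine ⟨n₁ + n₂, B₁ + B₂, by omega, ?_, ?_⟩
  · rw [← hsum, Multiset.map_add]
    exact hreach₁.add hreach₂
  · intro e he
    exact (Multiset.mem_add.1 he).elim (hB₁ e) (hB₂ e)

/-- Merging the colors of the two switched edges transports an even coloring along a switching,
at the cost of at most one color. -/
theorem Switching.exists_mem_evenColorCounts [Finite V] {G H : MultiGraph V} (h : Switching G H)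
    {k : ℕ} (hk : k ∈ evenColorCounts H) : ∃ l ∈ evenColorCounts G, k ≤ l + 1 := by
  classical
  obtain ⟨v, w, v', w', R, rfl, rfl⟩ := h
  obtain ⟨C, hC, _, K, f, hK, hf, hne, hg, rfl⟩ := mem_evenColorCounts_iff.1 hk
  obtain ⟨⟨e, a⟩, hx, he, hK⟩ := (Multiset.map_eq_cons _ _ _ _).2 hK
  obtain ⟨⟨e', b⟩, hy, he', hR⟩ := (Multiset.map_eq_cons _ _ _ _).2 hK
  dsimp only at he he'
  subst he he'
  obtain ⟨K, rfl⟩ := Multiset.exists_cons_of_mem hx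
  rw [Multiset.erase_cons_head] at hy hR
  obtain ⟨K, rfl⟩ := Multiset.exists_cons_of_mem hy
  rw [Multiset.erase_cons_head] at hR
  let g : C → C := fun c => if c = b then a else c
  have hga : g a = a := by simp [g]
  have hgb : g b = a := by simp [g]
  let K' : Multiset (Sym2 V × C) := (s(v, w), a) ::ₘ (s(v', w'), a) ::ₘ K.map (Prod.map id g)
  -- A switching preserves the total number of half-edges of the two edges at each vertex, so once
  -- both have color `a` the neighborhoods before and after agree.
  have hnbhd : ∀ x, nbhd K' x =
      (nbhd ((s(v, v'), a) ::ₘ (s(w, w'), b) ::ₘ K) x).map g := by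
    intro x
    rw [← nbhd_map]
    simp only [K', Multiset.map_cons, Prod.map_apply, id, hga, hgb, nbhd_cons, ← add_assoc,
      ← add_nsmul, inc_switch]
  refine ⟨_, mem_evenColorCounts_iff.2 ⟨C, hC, inferInstance, K', f, ?_, hf, hne,
    fun x => by rw [hnbhd, hnbhd, hg], rfl⟩, ?_⟩
  · simp [K', Multiset.map_map, ← hR]
  · rw [← tsub_le_iff_right]
    -- Only the color `b` can disappear.
    refine (Finset.pred_card_le_card_erase (a := b)).trans (Finset.card_le_card ?_)
    intro c hc
    simp only [Finset.mem_erase, Multiset.map_cons, Multiset.toFinset_cons, Finset.mem_insert,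
      Multiset.mem_toFinset, Multiset.mem_map, K', Multiset.map_map] at hc ⊢
    obtain ⟨hcb, rfl | rfl | ⟨y, hy, rfl⟩⟩ := hc
    · exact .inl rfl
    · exact absurd rfl hcb
    · exact .inr (.inr ⟨y, hy, by simp [g, hcb]⟩)

end Colored

/-! ### Disjoint unions of Frobenius pairs -/

section Frobenius

variable {V : Type*} [Fintype V] [DecidableEq V]

/-- A regular multigraph all of whose edges join vertices matched by a fixed-point-free involution
is a disjoint union of Frobenius pairs. -/
theorem mem_frobenii_of_matched {p : ℕ} {f : V → V} (hf : ∀ v, f (f v) = v)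
    (hne : ∀ v, f v ≠ v) (F : WithDegrees V fun _ => p) (hF : ∀ e ∈ F.1, ∃ v, e = s(v, f v)) :
    F ∈ frobenii V p := by
  have huniq : ∀ v x : V, v ∈ s(x, f x) → s(x, f x) = s(v, f v) := by
    intro v x h
    rcases Sym2.mem_iff.1 h with rfl | rfl
    · rfl
    · rw [hf, Sym2.eq_swap]
  have hcount : ∀ v, F.1.count s(v, f v) = p := by
    intro v
    -- Regularity is dropped so that induction on the edges is possible.
    have hG : ∀ G : MultiGraph V, (∀ e ∈ G, ∃ v, e = s(v, f v)) →
        G.count s(v, f v) = degree G v := by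
      intro G hG
      induction G using Multiset.induction with
      | empty => rfl
      | cons e G ih =>
        rw [Multiset.count_cons, degree_cons, ih fun e he => hG e (Multiset.mem_cons_of_mem he),
          add_comm]
        congr 1
        obtain ⟨x, rfl⟩ := hG e (Multiset.mem_cons_self _ _)
        by_cases hv : v ∈ s(x, f x)
        · rw [huniq v x hv, if_pos rfl, inc_mk]
          simp [(hne v).symm]
        · rw [inc_eq_zero_iff.2 hv, if_neg]
          intro h
          exact hv (h ▸ Sym2.mem_mk_left _ _)
    rw [hG _ hF]
    exact F.2 v
  refine ⟨Finset.univ.image fun v => s(v, f v), ?_, ?_, ?_⟩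
  · intro e he
    obtain ⟨v, -, rfl⟩ := Finset.mem_image.1 he
    simpa using (hne v).symm
  · intro v
    refine ⟨s(v, f v), ⟨Finset.mem_image_of_mem _ (Finset.mem_univ v), Sym2.mem_mk_left _ _⟩, ?_⟩
    rintro e ⟨he, hv⟩
    obtain ⟨x, -, rfl⟩ := Finset.mem_image.1 he
    exact huniq v x hv
  · ext e
    rw [Multiset.count_sum']
    simp only [Multiset.count_replicate]
    rw [Finset.sum_ite_eq']
    split_ifs with he
    · obtain ⟨x, -, rfl⟩ := Finset.mem_image.1 he
      exact hcount x
    · refine Multiset.count_eq_zero.2 fun hmem => he ?_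
      obtain ⟨x, rfl⟩ := hF e hmem
      exact Finset.mem_image_of_mem _ (Finset.mem_univ x)

/-- In a disjoint union of Frobenius pairs, all edges may be given different colors. -/
theorem card_mem_evenColorCounts_of_mem_frobenii {p : ℕ} {F : WithDegrees V fun _ => p}
    (hF : F ∈ frobenii V p) : Multiset.card F.1 ∈ evenColorCounts F.1 := by
  obtain ⟨M, hdiag, huniq, hM⟩ := hF
  choose m hm hm' using huniq
  choose f hf using fun v => Sym2.mem_iff_exists.1 (hm v).2
  have hmf : ∀ v, m (f v) = m v := fun v =>
    (hm' (f v) (m v) ⟨(hm v).1, by rw [hf v]; exact Sym2.mem_mk_right _ _⟩).symm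
  have hff : ∀ v, f (f v) = v := by
    intro v
    have h := hf (f v)
    rw [hmf, hf v, Sym2.eq_swap] at h
    exact (Sym2.congr_right.1 h).symm
  have hne : ∀ v, f v ≠ v := by
    intro v h
    refine hdiag (m v) (hm v).1 ?_
    rw [hf v, h]
    exact Sym2.mk_isDiag_iff.2 rfl
  have hedge : ∀ e ∈ F.1, ∃ v, e = s(v, f v) := by
    intro e he
    rw [hM, Multiset.mem_sum] at he
    obtain ⟨e', he', h⟩ := he
    obtain rfl := Multiset.eq_of_mem_replicate h
    induction e with | _ v w
    exact ⟨v, by rw [← hf v]; exact hm' v _ ⟨he', Sym2.mem_mk_left _ _⟩⟩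
  -- Every edge gets its own color; it has equally many half-edges at `v` and `f v`, so the matching
  -- preserves neighborhoods.
  let ε := Fintype.equivFin F.1
  refine ⟨Fin (Fintype.card F.1), inferInstance, ε, (even_ncard_fibers_iff _).2
    ⟨f, hff, hne, fun v => Finset.sum_congr rfl fun e _ => ?_⟩, ?_⟩
  · obtain ⟨x, hx⟩ := hedge e (Multiset.coe_mem)
    rw [hx, inc_matched hff]
  · rw [ε.surjective.range_eq, Set.ncard_univ]
    simp

theorem exists_evenColorCounts_of_walk {p : ℕ} {G F : WithDegrees V fun _ => p}
    (w : (switchGraph V fun _ => p).Walk G F) (hF : F ∈ frobenii V p) :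
    ∃ k ∈ evenColorCounts G.1, Multiset.card G.1 ≤ k + w.length := by
  induction w with
  | nil => exact ⟨_, card_mem_evenColorCounts_of_mem_frobenii hF, le_rfl⟩
  | @cons G H F hadj w ih =>
    obtain ⟨k, hk, hle⟩ := ih hF
    have hs : Switching G.1 H.1 :=
      ((SimpleGraph.fromRel_adj _ _ _).1 hadj).2.elim id Switching.symm
    obtain ⟨l, hl, hkl⟩ := hs.exists_mem_evenColorCounts hk
    refine ⟨l, hl, ?_⟩
    rw [hs.card_eq, SimpleGraph.Walk.length_cons]
    omega

end Frobenius

end MultiGraph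

/-! ### The main theorem, with finiteness of the distance implied by the equation in `ℕ∞` -/

open MultiGraph in
theorem mainTheorem9 {V : Type*} [Fintype V] [DecidableEq V] (hV : Even (Fintype.card V))
    (p : ℕ) (G : MultiGraph.WithDegrees V fun _ => p) :
    (MultiGraph.cMax G.1 : ℕ∞) + MultiGraph.dSwitchSet G (MultiGraph.frobenii V p)
      = (Multiset.card G.1 : ℕ∞) := by
  have hmax := isGreatest_cMax hV G
  apply le_antisymm
  · obtain ⟨C, _, _, K, f, hK, hf, hne, hg, hcol⟩ := mem_evenColorCounts_iff.1 hmax.1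
    obtain ⟨n, B, hle, hreach, hB⟩ := exists_switchReach_matched_of_colored hf hne K hg
    rw [hK] at hreach
    obtain ⟨hdeg, hdist⟩ := hreach.exists_edist_le G.2
    have hmem := mem_frobenii_of_matched hf hne ⟨B, hdeg⟩ hB
    calc (cMax G.1 : ℕ∞) + dSwitchSet G (frobenii V p)
        ≤ cMax G.1 + n := by gcongr; exact (iInf₂_le _ hmem).trans hdist
      _ ≤ Multiset.card G.1 := by
        rw [hcol] at hle
        rw [← hK, Multiset.card_map, hK]
        exact_mod_cast (add_comm _ _).trans_le hle
  · rw [← tsub_le_iff_left]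
    refine le_iInf₂ fun F hF => ?_
    rw [tsub_le_iff_left]
    by_cases htop : dSwitch G F = ⊤
    · simp [htop]
    obtain ⟨w, hw⟩ := SimpleGraph.exists_walk_of_edist_ne_top htop
    obtain ⟨k, hk, hle⟩ := exists_evenColorCounts_of_walk w hF
    rw [dSwitch, ← hw]
    exact_mod_cast hle.trans (Nat.add_le_add_right (hmax.2 hk) _)
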